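/- Let $\Sigma$ be a compact connected Riemann surface (without boundary) and let $\tau:\Sigma\to\Sigma$ be a real structure, i.e. an anti-holomorphic involution: $\tau\circ\tau=\mathrm{Id}_\Sigma$, $\tau$ is (real) differentiable, and for every $x\in\Sigma$ the tangent map $T_x\tau:T_x\Sigma\to T_{\tau(x)}\Sigma$ is $\mathbb{C}$-antilinear. Then the fixed-point set $\mathrm{Fix}(\tau)=\{x\in\Sigma : \tau(x)=x\}$ is a finite (possibly empty) disjoint union of smoothly embedded circles: there are an integer $n\ge 0$ and $C^\infty$ embeddings $\gamma_1,\dots,\gamma_n:S^1\to\Sigma$ with pairwise disjoint images such that $\mathrm{Fix}(\tau)=\bigcup_{i=1}^n\gamma_i(S^1)$. -/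

import Mathlib

open scoped Manifold ContDiff ComplexConjugate

/-- The tangent map `T_x S → T_{τ x} S` of a map `τ : S → S` between real surfaces underlying a
Riemann surface `S`, seen as a map between the complex tangent lines of `S`. Both tangent spaces
at `x` are read in the same preferred chart at `x`, so the complex structure on the real tangent
space is the one of the Riemann surface. -/
noncomputable def realTangentMap {S : Type*} [TopologicalSpace S] [ChartedSpace ℂ S]
    (τ : S → S) (x : S) : TangentSpace 𝓘(ℂ, ℂ) x → TangentSpace 𝓘(ℂ, ℂ) (τ x) :=
  fun v => mfderiv 𝓘(ℝ, ℂ) 𝓘(ℝ, ℂ) τ x v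

/-- A real structure on a Riemann surface `S`: an anti-holomorphic involution `τ`, that is, a
(real) differentiable map with `τ ∘ τ = id` whose tangent map `T_x S → T_{τ x} S` is
`ℂ`-antilinear at every point `x`. Additivity of the tangent map is automatic. -/
structure IsRealStructure {S : Type*} [TopologicalSpace S] [ChartedSpace ℂ S]
    (τ : S → S) : Prop where
  involutive : Function.Involutive τ
  mdifferentiable : MDifferentiable 𝓘(ℝ, ℂ) 𝓘(ℝ, ℂ) τ
  antilinear : ∀ (x : S) (c : ℂ) (v : TangentSpace 𝓘(ℂ, ℂ) x),
    realTangentMap τ x (c • v) = conj c • realTangentMap τ x v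

/-! Near a fixed point `p`, read `τ` in a holomorphic chart and conjugate: antilinearity makes the
result `g` holomorphic. For a suitable constant `b` the function `f z = b * z + conj b * g z` has
nonzero derivative at the image of `p`, and it satisfies `f ∘ τ = conj f`. So it is a holomorphic
coordinate in which `τ` is complex conjugation and its fixed points form the real axis
(`IsRealStructure.exists_chart`). The fixed locus is therefore a closed smooth curve in a compact
surface, and what remains is the classification of such curves.

Immerse the surface in a Euclidean space and parametrize the curve by arc length. Transition maps
between arc length charts have derivative `±1`, hence are locally `t ↦ a ± t`
(`IsUnitSpeedChart.compatible`). The rest is topology of a compact space with such an atlas. Local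
isometries from an interval extend to all of `ℝ` (`IsIsometricAtlas.exists_global`); their ranges
are open, and equal or disjoint, so finitely many of them cover. The periods of each form a discrete
subgroup, which is nonzero because `ℝ` is not compact (`IsIsometricAtlas.exists_period`), so each
range is a circle.

Finally, a periodic local isometry factors through `Circle`. Arc length coordinates extend locally
to smooth functions on the surface, which gives the induced map smooth local inverses and makes it
an embedding (`exists_isSmoothEmbedding_of_periodic`). -/

section

open Set Filter Topology

/-! ### Spaces with an isometric one-dimensional atlas, and germs of local isometries. -/

section IsometricAtlas

variable {X : Type*} [TopologicalSpace X]

/-- A family of charts with values in `ℝ` covering `X`, all of whose transition maps are locally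
isometries of `ℝ`. -/
structure IsIsometricAtlas (A : Set (OpenPartialHomeomorph X ℝ)) : Prop where
  exists_mem_source : ∀ x, ∃ e ∈ A, x ∈ e.source
  compatible : ∀ e ∈ A, ∀ e' ∈ A, ∀ x ∈ e.source, x ∈ e'.source →
    ∃ σ : ℝ, σ * σ = 1 ∧ ∀ᶠ y in 𝓝 x, e' y = e' x + σ * (e y - e x)

/-- The curve `γ` is a local isometry at time `t`, as seen in a chart of `A`. -/
def IsLocalIsometryAt (A : Set (OpenPartialHomeomorph X ℝ)) (γ : ℝ → X) (t : ℝ) : Prop :=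
  ∃ e ∈ A, γ t ∈ e.source ∧ ∃ σ : ℝ, σ * σ = 1 ∧
    ∀ᶠ s in 𝓝 t, γ s = e.symm (e (γ t) + σ * (s - t))

variable {A : Set (OpenPartialHomeomorph X ℝ)} {γ γ₁ γ₂ : ℝ → X} {s t t₁ t₂ : ℝ}

lemma tendsto_add_mul_sub (a σ t : ℝ) : Tendsto (fun s : ℝ => a + σ * (s - t)) (𝓝 t) (𝓝 a) := by
  have : Continuous fun s : ℝ => a + σ * (s - t) := by fun_prop
  simpa using this.tendsto t

namespace IsLocalIsometryAt

lemma continuousAt (h : IsLocalIsometryAt A γ t) : ContinuousAt γ t := by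
  obtain ⟨e, -, hx, σ, -, h⟩ := h
  have h1 : ContinuousAt (fun s => e.symm (e (γ t) + σ * (s - t))) t := by
    have h2 : ContinuousAt e.symm (e (γ t)) := e.continuousAt_symm (e.map_source hx)
    have h3 := h2.tendsto.comp (tendsto_add_mul_sub (e (γ t)) σ t)
    simpa [ContinuousAt, Function.comp_def] using h3
  exact h1.congr (h.mono fun _ hs => hs.symm)

lemma congr (h : IsLocalIsometryAt A γ₁ t) (hγ : γ₁ =ᶠ[𝓝 t] γ₂) : IsLocalIsometryAt A γ₂ t := by
  obtain ⟨e, he, hx, σ, hσ, h⟩ := h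
  have := hγ.eq_of_nhds
  refine ⟨e, he, this ▸ hx, σ, hσ, ?_⟩
  filter_upwards [h, hγ] with s h1 h2
  rw [← h2, h1, this]

/-- The chart in the definition of a local isometry can be chosen freely. -/
lemma of_mem (hA : IsIsometricAtlas A) (h : IsLocalIsometryAt A γ t)
    {e : OpenPartialHomeomorph X ℝ} (he : e ∈ A) (hx : γ t ∈ e.source) :
    ∃ σ : ℝ, σ * σ = 1 ∧ ∀ᶠ s in 𝓝 t, γ s ∈ e.source ∧ e (γ s) = e (γ t) + σ * (s - t) := by
  have hc := h.continuousAt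
  obtain ⟨e₀, he₀, hx₀, σ, hσ, h⟩ := h
  obtain ⟨σ', hσ', h'⟩ := hA.compatible e₀ he₀ e he _ hx₀ hx
  refine ⟨σ' * σ, by linear_combination σ * σ * hσ' + hσ, ?_⟩
  filter_upwards [h, hc.eventually h', hc (e.open_source.mem_nhds hx),
    tendsto_add_mul_sub (e₀ (γ t)) σ t (e₀.open_target.mem_nhds (e₀.map_source hx₀))] with s h1 h2 h3 h4
  refine ⟨h3, ?_⟩
  rw [h2, h1, e₀.right_inv h4]
  ring

lemma eventually_eq_symm (hA : IsIsometricAtlas A) (h : IsLocalIsometryAt A γ t)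
    {e : OpenPartialHomeomorph X ℝ} (he : e ∈ A) (hx : γ t ∈ e.source) :
    ∃ σ : ℝ, σ * σ = 1 ∧ ∀ᶠ s in 𝓝 t, γ s = e.symm (e (γ t) + σ * (s - t)) := by
  obtain ⟨σ, hσ, h⟩ := h.of_mem hA he hx
  refine ⟨σ, hσ, h.mono fun s hs => ?_⟩
  rw [← hs.2, e.left_inv hs.1]

lemma comp_affine {a c : ℝ} (hc : c * c = 1) (h : IsLocalIsometryAt A γ (a + c * t)) :
    IsLocalIsometryAt A (fun s => γ (a + c * s)) t := by
  obtain ⟨e, he, hx, σ, hσ, h⟩ := h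
  refine ⟨e, he, hx, σ * c, by linear_combination c * c * hσ + hc, ?_⟩
  have : Tendsto (fun s : ℝ => a + c * s) (𝓝 t) (𝓝 (a + c * t)) :=
    Continuous.tendsto (by fun_prop) t
  filter_upwards [this.eventually h] with s hs
  rw [hs]
  congr 1
  ring

lemma comp_add_left {a : ℝ} (h : IsLocalIsometryAt A γ (a + t)) :
    IsLocalIsometryAt A (fun s => γ (a + s)) t := by
  simpa using comp_affine (c := 1) (a := a) (t := t) (by norm_num) (by simpa using h)

/-- Two local isometries through the same point agree up to the direction. -/
lemma exists_germ_eq (hA : IsIsometricAtlas A) (h₁ : IsLocalIsometryAt A γ₁ t₁)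
    (h₂ : IsLocalIsometryAt A γ₂ t₂) (h : γ₁ t₁ = γ₂ t₂) :
    ∃ σ : ℝ, σ * σ = 1 ∧ ∀ᶠ u in 𝓝 (0 : ℝ), γ₁ (t₁ + u) = γ₂ (t₂ + σ * u) := by
  obtain ⟨e, he, hx⟩ := hA.exists_mem_source (γ₁ t₁)
  obtain ⟨σ₁, hσ₁, H₁⟩ := h₁.eventually_eq_symm hA he hx
  obtain ⟨σ₂, hσ₂, H₂⟩ := h₂.eventually_eq_symm hA he (h ▸ hx)
  refine ⟨σ₂ * σ₁, by linear_combination σ₁ * σ₁ * hσ₂ + hσ₁, ?_⟩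
  have l₁ : Tendsto (fun u : ℝ => t₁ + u) (𝓝 0) (𝓝 t₁) := by
    simpa using (Continuous.tendsto (by fun_prop) (0 : ℝ) : Tendsto (fun u : ℝ => t₁ + u) _ _)
  have l₂ : Tendsto (fun u : ℝ => t₂ + σ₂ * σ₁ * u) (𝓝 0) (𝓝 t₂) := by
    simpa using (Continuous.tendsto (by fun_prop) (0 : ℝ) :
      Tendsto (fun u : ℝ => t₂ + σ₂ * σ₁ * u) _ _)
  filter_upwards [l₁.eventually H₁, l₂.eventually H₂] with u hu₁ hu₂
  rw [hu₁, hu₂, h]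
  congr 2
  linear_combination -σ₁ * u * hσ₂

/-- Local isometries are injective near each time. -/
lemma eventually_injective (hA : IsIsometricAtlas A) (h : IsLocalIsometryAt A γ t) :
    ∃ U ∈ 𝓝 t, InjOn γ U := by
  obtain ⟨e, he, hx⟩ := hA.exists_mem_source (γ t)
  obtain ⟨σ, hσ, H⟩ := h.of_mem hA he hx
  refine ⟨_, H, fun a ha b hb hab => ?_⟩
  have ha := ha.2
  have hb := hb.2
  rw [hab] at ha
  have : σ * (a - b) = 0 := by linear_combination hb - ha
  linear_combination σ * this - (a - b) * hσ

/-- A local isometry is inverted by charts, up to direction. -/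
lemma exists_eventually_apply_eq (hA : IsIsometricAtlas A) (h : IsLocalIsometryAt A γ t) :
    ∃ e ∈ A, γ t ∈ e.source ∧ ∃ σ : ℝ, σ * σ = 1 ∧
      ∀ᶠ y in 𝓝 (γ t), γ (t + σ * (e y - e (γ t))) = y := by
  obtain ⟨e, he, hx⟩ := hA.exists_mem_source (γ t)
  obtain ⟨σ, hσ, H⟩ := h.eventually_eq_symm hA he hx
  have h1 : Tendsto (fun y => t + σ * (e y - e (γ t))) (𝓝 (γ t)) (𝓝 t) :=
    (tendsto_add_mul_sub t σ (e (γ t))).comp (e.continuousAt hx).tendsto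
  refine ⟨e, he, hx, σ, hσ, ?_⟩
  filter_upwards [h1 H, e.open_source.mem_nhds hx] with y hy hy'
  rw [hy]
  conv_rhs => rw [← e.left_inv hy']
  congr 1
  linear_combination (e y - e (γ t)) * hσ

/-- Points near `γ t` are reached at the nearby times read off from a chart; this is openness of `γ`
at `t`. -/
lemma map_nhds (hA : IsIsometricAtlas A) (h : IsLocalIsometryAt A γ t) :
    𝓝 (γ t) ≤ map γ (𝓝 t) := by
  obtain ⟨e, he, hx, σ, -, H⟩ := h.exists_eventually_apply_eq hA
  have h1 : Tendsto (fun y => t + σ * (e y - e (γ t))) (𝓝 (γ t)) (𝓝 t) :=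
    (tendsto_add_mul_sub t σ (e (γ t))).comp (e.continuousAt hx).tendsto
  intro U hU
  filter_upwards [h1 hU, H] with y hy hy'
  rw [← hy']
  exact hy

/-- **Unique continuation** of local isometries. -/
lemma eqOn [T2Space X] (hA : IsIsometricAtlas A) {I : Set ℝ} (hI : IsPreconnected I)
    (h₁ : ∀ t ∈ I, IsLocalIsometryAt A γ₁ t)
    (h₂ : ∀ t ∈ I, IsLocalIsometryAt A γ₂ t) (ht : t ∈ I) (h : γ₁ =ᶠ[𝓝 t] γ₂) :
    EqOn γ₁ γ₂ I := by
  have key : I ⊆ {s | γ₁ =ᶠ[𝓝 s] γ₂} := by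
    apply hI.subset_of_closure_inter_subset
    · exact isOpen_setOfPred_eventually_nhds
    · exact ⟨t, ht, h⟩
    · rintro s ⟨hs, hsI⟩
      have hfr : ∃ᶠ r in 𝓝 s, γ₁ =ᶠ[𝓝 r] γ₂ := mem_closure_iff_frequently.1 hs
      have heq : γ₁ s = γ₂ s := by
        by_contra hne
        have := (((h₁ s hsI).continuousAt.tendsto.prodMk_nhds (h₂ s hsI).continuousAt.tendsto)
          (isClosed_diagonal.isOpen_compl.mem_nhds (by simpa using hne)))
        obtain ⟨r, hr, hr'⟩ := (hfr.and_eventually this).exists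
        exact hr' (by simpa using hr.eq_of_nhds)
      obtain ⟨e, he, hx⟩ := hA.exists_mem_source (γ₁ s)
      obtain ⟨σ₁, hσ₁, H₁⟩ := (h₁ s hsI).of_mem hA he hx
      obtain ⟨σ₂, hσ₂, H₂⟩ := (h₂ s hsI).of_mem hA he (heq ▸ hx)
      -- At a time `r` close to `s` the germs agree while both curves are still affine in `e`, with
      -- slopes `σ₁` and `σ₂`. Agreement around `r` forces equal slopes, hence equal germs at `s`.
      obtain ⟨r, hr, hr₁, hr₂⟩ := (hfr.and_eventually
        (H₁.eventually_nhds.and H₂.eventually_nhds)).exists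
      have hd : ∀ᶠ u in 𝓝 r, (σ₁ - σ₂) * (u - s) = 0 := by
        filter_upwards [hr, hr₁, hr₂] with u hu hu₁ hu₂
        have h3 := hu₁.2
        rw [hu, hu₂.2, heq] at h3
        linear_combination -h3
      have hσ : σ₁ = σ₂ := by
        obtain ⟨ε, hε, hd⟩ := Metric.eventually_nhds_iff.1 hd
        have e1 := hd (y := r) (by simpa using hε)
        have e2 := hd (y := r + ε / 2) (by simp [abs_of_pos hε, hε])
        have : (σ₁ - σ₂) * (ε / 2) = 0 := by linear_combination e2 - e1
        have := (mul_eq_zero.1 this).resolve_right (by positivity)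
        linarith
      filter_upwards [H₁, H₂] with u hu₁ hu₂
      apply e.injOn hu₁.1 hu₂.1
      rw [hu₁.2, hu₂.2, hσ, heq]
  exact fun s hs => (key hs).eq_of_nhds

end IsLocalIsometryAt

/-! ### Global uniqueness and existence of local isometries. -/

variable [T2Space X]

/-- The germs agree up to direction, and unique continuation spreads this over the connected line.
-/
lemma IsIsometricAtlas.eq_of_forall (hA : IsIsometricAtlas A)
    (h₁ : ∀ t, IsLocalIsometryAt A γ₁ t) (h₂ : ∀ t, IsLocalIsometryAt A γ₂ t)
    (h : γ₁ t₁ = γ₂ t₂) :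
    ∃ σ : ℝ, σ * σ = 1 ∧ ∀ u, γ₁ (t₁ + u) = γ₂ (t₂ + σ * u) := by
  obtain ⟨σ, hσ, H⟩ := (h₁ t₁).exists_germ_eq hA (h₂ t₂) h
  refine ⟨σ, hσ, fun u => ?_⟩
  exact IsLocalIsometryAt.eqOn (γ₁ := fun u => γ₁ (t₁ + u)) (γ₂ := fun u => γ₂ (t₂ + σ * u))
    hA isPreconnected_univ
    (fun s _ => (h₁ _).comp_add_left) (fun s _ => (h₂ _).comp_affine hσ) (mem_univ 0) H (mem_univ u)

omit [T2Space X] in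
/-- On a compact space there are local isometries of uniform length through all points. -/
lemma IsIsometricAtlas.exists_uniform [CompactSpace X] (hA : IsIsometricAtlas A) :
    ∃ ε > 0, ∀ x, ∃ γ : ℝ → X, γ 0 = x ∧ ∀ t ∈ Ioo (-ε) ε, IsLocalIsometryAt A γ t := by
  choose e he hx using hA.exists_mem_source
  -- The doubled radius leaves room `r` on both sides of every start within `r` of the centre.
  have h1 : ∀ x, ∃ r > 0, Metric.ball (e x x) (r + r) ⊆ (e x).target := fun x => by
    obtain ⟨r, hr, h⟩ := Metric.isOpen_iff.1 (e x).open_target _ ((e x).map_source (hx x))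
    exact ⟨r / 2, by positivity, by simpa using h⟩
  choose r hr hball using h1
  have h2 : ∀ x, (e x).source ∩ e x ⁻¹' Metric.ball (e x x) (r x) ∈ 𝓝 x := fun x =>
    ((e x).isOpen_inter_preimage Metric.isOpen_ball).mem_nhds ⟨hx x, Metric.mem_ball_self (hr x)⟩
  obtain ⟨T, hT⟩ := CompactSpace.elim_nhds_subcover _ h2
  obtain ⟨ε, hε, hεT⟩ : ∃ ε > 0, ∀ x ∈ T, ε ≤ r x := by
    rcases T.eq_empty_or_nonempty with rfl | hne
    · exact ⟨1, one_pos, by simp⟩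
    · exact ⟨T.inf' hne r, (Finset.lt_inf'_iff hne).2 fun x _ => hr x,
        fun x hx => Finset.inf'_le _ hx⟩
  refine ⟨ε, hε, fun y => ?_⟩
  have hy : y ∈ ⋃ x ∈ T, (e x).source ∩ e x ⁻¹' Metric.ball (e x x) (r x) := hT ▸ mem_univ y
  simp only [mem_iUnion] at hy
  obtain ⟨x, hxT, hy1, hy2⟩ := hy
  have hmem : ∀ t ∈ Ioo (-ε) ε, e x y + t ∈ (e x).target := fun t ht => by
    apply hball
    rw [Metric.mem_ball]
    calc dist (e x y + t) (e x x) ≤ dist (e x y + t) (e x y) + dist (e x y) (e x x) :=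
          dist_triangle _ _ _
      _ < r x + r x := by
          refine add_lt_add ?_ hy2
          simp only [dist_self_add_left, Real.norm_eq_abs]
          exact (abs_lt.2 ht).trans_le (hεT x hxT)
  refine ⟨fun t => (e x).symm (e x y + t), by simp [hy1], fun t ht => ?_⟩
  refine ⟨e x, he x, (e x).map_target (hmem t ht), 1, by norm_num, Eventually.of_forall fun s => ?_⟩
  rw [(e x).right_inv (hmem t ht)]
  ring_nf

/-- A curve of uniform length `ε`, started at time `b - ε / 2` and reversed if necessary, reaches `b
+ ε / 2`. It agrees with `γ` on the overlap by unique continuation, so the two glue. -/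
lemma IsIsometricAtlas.exists_extend_right (hA : IsIsometricAtlas A) {ε : ℝ} (hε : 0 < ε)
    (hu : ∀ x, ∃ γ : ℝ → X, γ 0 = x ∧ ∀ t ∈ Ioo (-ε) ε, IsLocalIsometryAt A γ t)
    {a b : ℝ} (hab : a < b - ε / 2) (hγ : ∀ t ∈ Ioo a b, IsLocalIsometryAt A γ t) :
    ∃ γ' : ℝ → X, EqOn γ' γ (Iio b) ∧ ∀ t ∈ Ioo a (b + ε / 2), IsLocalIsometryAt A γ' t := by
  obtain ⟨t₀, ht₀⟩ : ∃ t₀, t₀ = b - ε / 2 := ⟨_, rfl⟩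
  obtain ⟨c, hc0, hc⟩ := hu (γ t₀)
  have hγt₀ : IsLocalIsometryAt A γ t₀ := hγ _ ⟨by linarith, by linarith⟩
  obtain ⟨σ, hσ, H⟩ := hγt₀.exists_germ_eq hA (hc 0 ⟨by linarith, hε⟩) hc0.symm
  have hc' : ∀ s ∈ Ioo (t₀ - ε) (t₀ + ε),
      IsLocalIsometryAt A (fun s => c (-σ * t₀ + σ * s)) s := fun s hs => by
    apply (hc _ _).comp_affine hσ
    rcases mul_self_eq_one_iff.1 hσ with rfl | rfl <;>
      constructor <;> linarith [hs.1, hs.2]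
  have hgerm : γ =ᶠ[𝓝 t₀] fun s => c (-σ * t₀ + σ * s) := by
    have : Tendsto (fun s : ℝ => s - t₀) (𝓝 t₀) (𝓝 0) := by
      simpa using (Continuous.tendsto (by fun_prop) t₀ : Tendsto (fun s : ℝ => s - t₀) _ _)
    filter_upwards [this.eventually H] with s hs
    rw [add_sub_cancel] at hs
    rw [hs]
    congr 1
    ring
  have heq : EqOn γ (fun s => c (-σ * t₀ + σ * s)) (Ioo (max a (t₀ - ε)) b) := by
    refine IsLocalIsometryAt.eqOn hA isPreconnected_Ioo (fun s hs => ?_) (fun s hs => ?_)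
      (t := t₀) ⟨max_lt (by linarith) (by linarith), by linarith⟩ hgerm
    · exact hγ s ⟨(le_max_left _ _).trans_lt hs.1, hs.2⟩
    · exact hc' s ⟨(le_max_right _ _).trans_lt hs.1, by linarith [hs.2]⟩
  refine ⟨fun s => if s < b then γ s else c (-σ * t₀ + σ * s), fun s hs => if_pos hs,
    fun t ht => ?_⟩
  rcases lt_or_ge t b with h | h
  · refine (hγ t ⟨ht.1, h⟩).congr ?_
    filter_upwards [Iio_mem_nhds h] with s hs
    exact (if_pos hs).symm
  · refine (hc' t ⟨by linarith, by linarith [ht.2]⟩).congr ?_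
    filter_upwards [Ioi_mem_nhds ((max_lt (by linarith) (by linarith) :
      max a (t₀ - ε) < b).trans_le h)] with s hs
    split_ifs with hsb
    · exact (heq ⟨hs, hsb⟩).symm
    · rfl

/-- Extend to the right, reverse time, and extend to the right again. -/
lemma IsIsometricAtlas.exists_extend (hA : IsIsometricAtlas A) {ε : ℝ} (hε : 0 < ε)
    (hu : ∀ x, ∃ γ : ℝ → X, γ 0 = x ∧ ∀ t ∈ Ioo (-ε) ε, IsLocalIsometryAt A γ t)
    {b : ℝ} (hb : ε ≤ b) (hγ : ∀ t ∈ Ioo (-b) b, IsLocalIsometryAt A γ t) :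
    ∃ γ' : ℝ → X, EqOn γ' γ (Ioo (-b) b) ∧
      ∀ t ∈ Ioo (-(b + ε / 2)) (b + ε / 2), IsLocalIsometryAt A γ' t := by
  have hneg : ∀ {γ : ℝ → X} {t : ℝ}, IsLocalIsometryAt A γ (-t) →
      IsLocalIsometryAt A (fun s => γ (-s)) t := fun {γ t} h => by
    have := IsLocalIsometryAt.comp_affine (a := 0) (c := -1) (t := t) (γ := γ) (A := A)
      (by norm_num) (by simpa using h)
    simpa using this
  obtain ⟨γ₁, h₁, h₁'⟩ := hA.exists_extend_right hε hu (by linarith) hγ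
  obtain ⟨γ₂, h₂, h₂'⟩ := hA.exists_extend_right hε hu (a := -(b + ε / 2)) (b := b)
    (γ := fun s => γ₁ (-s)) (by linarith)
    (fun t ht => hneg (h₁' _ ⟨by linarith [ht.2], by linarith [ht.1]⟩))
  refine ⟨fun s => γ₂ (-s), fun s hs => ?_, fun t ht => ?_⟩
  · have := h₂ (x := -s) (by simp only [mem_Iio]; linarith [hs.1])
    simp only [neg_neg] at this
    rw [← h₁ hs.2, ← this]
  · exact hneg (h₂' _ ⟨by linarith [ht.2], by linarith [ht.1]⟩)

/-- On a compact space, local isometries are defined for all times. -/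
lemma IsIsometricAtlas.exists_global [CompactSpace X] (hA : IsIsometricAtlas A) (x : X) :
    ∃ γ : ℝ → X, γ 0 = x ∧ ∀ t, IsLocalIsometryAt A γ t := by
  obtain ⟨ε, hε, hu⟩ := hA.exists_uniform
  obtain ⟨c, hc0, hc⟩ := hu x
  -- Each stage keeps the same curve `c` around time `0`; this is what lets unique continuation
  -- identify different stages on their common interval.
  have key : ∀ n : ℕ, ∃ γ : ℝ → X, EqOn γ c (Ioo (-ε) ε) ∧
      ∀ t ∈ Ioo (-(ε + n * (ε / 2))) (ε + n * (ε / 2)), IsLocalIsometryAt A γ t := by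
    intro n
    induction n with
    | zero => exact ⟨c, fun _ _ => rfl, by simpa using hc⟩
    | succ n ih =>
      obtain ⟨γ, h, h'⟩ := ih
      have hn : ε ≤ ε + n * (ε / 2) := by
        have : 0 ≤ n * (ε / 2) := by positivity
        linarith
      obtain ⟨γ', h₁, h₂⟩ := hA.exists_extend hε hu hn h'
      refine ⟨γ', (h₁.mono (Ioo_subset_Ioo (by linarith) hn)).trans h, ?_⟩
      convert! h₂ using 4 <;> push_cast <;> ring
  choose g hg hg' using key
  have hL : ∀ n : ℕ, 0 ≤ n * (ε / 2) := fun n => by positivity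
  have hcomp' : ∀ m n : ℕ, m ≤ n →
      EqOn (g m) (g n) (Ioo (-(ε + m * (ε / 2))) (ε + m * (ε / 2))) := fun m n hmn => by
    have hmn' : m * (ε / 2) ≤ n * (ε / 2) := by gcongr
    refine IsLocalIsometryAt.eqOn hA isPreconnected_Ioo (hg' m)
      (fun t ht => hg' n t ⟨by linarith [ht.1], by linarith [ht.2]⟩) (t := 0)
      ⟨by linarith [hL m], by linarith [hL m]⟩ ?_
    filter_upwards [Ioo_mem_nhds (neg_lt_zero.2 hε) hε] with s hs
    rw [hg m hs, hg n hs]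
  have hcomp : ∀ m n : ℕ, ∀ t ∈ Ioo (-(ε + m * (ε / 2))) (ε + m * (ε / 2)),
      t ∈ Ioo (-(ε + n * (ε / 2))) (ε + n * (ε / 2)) → g m t = g n t := fun m n t hm hn => by
    rcases le_total m n with h | h
    · exact hcomp' m n h hm
    · exact (hcomp' n m h hn).symm
  have hN : ∀ t : ℝ, ∃ n : ℕ, t ∈ Ioo (-(ε + n * (ε / 2))) (ε + n * (ε / 2)) := fun t => by
    obtain ⟨n, hn⟩ := exists_nat_ge (|t| / (ε / 2))
    rw [div_le_iff₀ (by positivity)] at hn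
    exact ⟨n, abs_lt.1 (by linarith)⟩
  choose N hN using hN
  refine ⟨fun t => g (N t) t, ?_, fun t => ?_⟩
  · rw [← hc0]
    exact hg _ ⟨by linarith, hε⟩
  · refine (hg' (N t) t (hN t)).congr ?_
    filter_upwards [Ioo_mem_nhds (hN t).1 (hN t).2] with s hs
    exact hcomp _ _ s hs (hN s)

/-! ### Ranges and periods; decomposition into circles. -/

omit [T2Space X] in
lemma IsIsometricAtlas.isOpenMap (hA : IsIsometricAtlas A)
    (hγ : ∀ t, IsLocalIsometryAt A γ t) : IsOpenMap γ :=
  IsOpenMap.of_nhds_le fun t => (hγ t).map_nhds hA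

lemma IsIsometricAtlas.range_subset (hA : IsIsometricAtlas A)
    (h₁ : ∀ t, IsLocalIsometryAt A γ₁ t) (h₂ : ∀ t, IsLocalIsometryAt A γ₂ t)
    (h : γ₁ t₁ = γ₂ t₂) : range γ₁ ⊆ range γ₂ := by
  obtain ⟨σ, -, H⟩ := hA.eq_of_forall h₁ h₂ h
  rintro _ ⟨s, rfl⟩
  have := H (s - t₁)
  rw [add_sub_cancel] at this
  exact ⟨_, this.symm⟩

lemma IsIsometricAtlas.range_eq_or_disjoint (hA : IsIsometricAtlas A)
    (h₁ : ∀ t, IsLocalIsometryAt A γ₁ t) (h₂ : ∀ t, IsLocalIsometryAt A γ₂ t) :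
    range γ₁ = range γ₂ ∨ Disjoint (range γ₁) (range γ₂) := by
  by_contra! hcon
  obtain ⟨_, ⟨t₁, rfl⟩, t₂, h⟩ := not_disjoint_iff.1 hcon.2
  exact hcon.1 ((hA.range_subset h₁ h₂ h.symm).antisymm (hA.range_subset h₂ h₁ h))

/-- The curve through a limit point has open range, hence meets `range γ`, hence lies inside it. -/
lemma IsIsometricAtlas.isClosed_range [CompactSpace X] (hA : IsIsometricAtlas A)
    (hγ : ∀ t, IsLocalIsometryAt A γ t) : IsClosed (range γ) := by
  refine isClosed_of_closure_subset fun x hx => ?_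
  obtain ⟨c, rfl, hc⟩ := hA.exists_global x
  obtain ⟨_, ⟨t₁, rfl⟩, t₂, h⟩ := mem_closure_iff.1 hx (range c)
    (hA.isOpenMap hc).isOpen_range ⟨0, rfl⟩
  exact hA.range_subset hc hγ h.symm ⟨0, rfl⟩

/-- A local isometry never turns back. -/
lemma IsIsometricAtlas.periodic_of_eq (hA : IsIsometricAtlas A)
    (hγ : ∀ t, IsLocalIsometryAt A γ t) (h : γ s = γ t) : Function.Periodic γ (s - t) := by
  obtain ⟨σ, hσ, H⟩ := hA.eq_of_forall hγ hγ h
  rcases mul_self_eq_one_iff.1 hσ with rfl | rfl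
  · intro u
    have := H (u - t)
    rw [one_mul, add_sub_cancel] at this
    rw [← this]
    congr 1
    ring
  -- If `σ = -1`, then `γ` is symmetric about the midpoint of `s` and `t`, against its injectivity
  -- near that time.
  · obtain ⟨U, hU, hinj⟩ := (hγ ((s + t) / 2)).eventually_injective hA
    obtain ⟨ε, hε, hU⟩ := Metric.mem_nhds_iff.1 hU
    have h1 := H ((t - s) / 2 + ε / 2)
    have h2 : s + ((t - s) / 2 + ε / 2) = t + -1 * ((t - s) / 2 + ε / 2) := by
      apply hinj (hU _) (hU _) h1
      · rw [Metric.mem_ball, Real.dist_eq, abs_lt]; constructor <;> linarith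
      · rw [Metric.mem_ball, Real.dist_eq, abs_lt]; constructor <;> linarith
    linarith

/-- On a compact space, all local isometries are periodic. -/
lemma IsIsometricAtlas.exists_period [CompactSpace X] (hA : IsIsometricAtlas A)
    (hγ : ∀ t, IsLocalIsometryAt A γ t) :
    ∃ T > 0, ∀ s t, γ s = γ t ↔ ∃ k : ℤ, s = t + k * T := by
  let P : AddSubgroup ℝ :=
    { carrier := {T | Function.Periodic γ T}
      add_mem' := fun h h' => h.add_period h'
      zero_mem' := fun t => by simp
      neg_mem' := fun h => h.neg }
  have hP : ∀ s t, γ s = γ t ↔ s - t ∈ P := fun s t => by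
    refine ⟨hA.periodic_of_eq hγ, fun h => ?_⟩
    have h1 : γ (t + (s - t)) = γ t := (show Function.Periodic γ (s - t) from h) t
    rwa [add_sub_cancel] at h1
  obtain ⟨U, hU, hinj⟩ := (hγ 0).eventually_injective hA
  obtain ⟨ε, hε, hU⟩ := Metric.mem_nhds_iff.1 hU
  have hdisj : Disjoint (P : Set ℝ) (Ioo 0 ε) := by
    rw [disjoint_left]
    intro T hT hT'
    have h1 : γ T = γ 0 := (hP T 0).2 (by simpa using hT)
    have := hinj (hU (by simp [abs_of_pos hT'.1, hT'.2])) (hU (by simpa using hε)) h1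
    exact hT'.1.ne' this
  obtain ⟨T, hT⟩ := AddSubgroup.cyclic_of_isolated_zero hε hdisj
  -- Without nonzero periods `γ` would be injective, embedding `ℝ` as a closed subset of a compact
  -- space.
  have hT0 : T ≠ 0 := by
    rintro rfl
    have hinj : Function.Injective γ := fun s t h => by
      have h1 := (hP s t).1 h
      rw [hT, AddSubgroup.mem_closure_singleton] at h1
      obtain ⟨k, hk⟩ := h1
      simp at hk
      linarith
    have hcont : Continuous γ := continuous_iff_continuousAt.2 fun t => (hγ t).continuousAt
    have hemb : IsClosedEmbedding γ :=
      ⟨(IsOpenEmbedding.of_continuous_injective_isOpenMap hcont hinj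
        (hA.isOpenMap hγ)).isEmbedding, hA.isClosed_range hγ⟩
    exact noncompact_univ ℝ hemb.compactSpace.isCompact_univ
  have hmem : ∀ u, u ∈ P ↔ ∃ k : ℤ, u = k * |T| := fun u => by
    rw [hT, AddSubgroup.mem_closure_singleton]
    simp only [zsmul_eq_mul]
    constructor
    · rintro ⟨k, rfl⟩
      rcases abs_choice T with h | h <;> rw [h]
      · exact ⟨k, rfl⟩
      · exact ⟨-k, by push_cast; ring⟩
    · rintro ⟨k, rfl⟩
      rcases abs_choice T with h | h <;> rw [h]
      · exact ⟨k, rfl⟩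
      · exact ⟨-k, by push_cast; ring⟩
  refine ⟨|T|, abs_pos.2 hT0, fun s t => ?_⟩
  rw [hP, hmem]
  simp only [sub_eq_iff_eq_add']

/-- **Classification of compact one-dimensional manifolds** with an isometric atlas: they are
finite disjoint unions of circles. -/
theorem IsIsometricAtlas.exists_finite_circles [CompactSpace X] (hA : IsIsometricAtlas A) :
    ∃ (n : ℕ) (γ : Fin n → ℝ → X) (T : Fin n → ℝ), (∀ i, 0 < T i) ∧
      (∀ i t, IsLocalIsometryAt A (γ i) t) ∧
      (∀ i s t, γ i s = γ i t ↔ ∃ k : ℤ, s = t + k * T i) ∧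
      Pairwise (fun i j => Disjoint (range (γ i)) (range (γ j))) ∧ ⋃ i, range (γ i) = univ := by
  classical
  choose c hc0 hc using hA.exists_global
  choose T hT hT' using fun x => hA.exists_period (hc x)
  obtain ⟨s, hs⟩ := CompactSpace.elim_nhds_subcover (fun x => range (c x)) fun x =>
    (hA.isOpenMap (hc x)).isOpen_range.mem_nhds ⟨0, hc0 x⟩
  -- Indexing by the ranges themselves, rather than by base points, removes repetitions.
  let R : Finset (Set X) := s.image fun x => range (c x)
  have hR : ∀ r : R, ∃ x, range (c x) = r := fun r => by
    obtain ⟨x, -, hx⟩ := Finset.mem_image.1 r.2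
    exact ⟨x, hx⟩
  choose x hx using hR
  let x' : Fin R.card → X := fun i => x (R.equivFin.symm i)
  refine ⟨R.card, fun i => c (x' i), fun i => T (x' i), fun i => hT _, fun i => hc _,
    fun i => hT' _, fun i j hij => ?_, ?_⟩
  · refine (hA.range_eq_or_disjoint (hc _) (hc _)).resolve_left fun h => hij ?_
    rw [hx, hx] at h
    exact R.equivFin.symm.injective (Subtype.ext h)
  · refine eq_univ_of_forall fun y => ?_
    have hy : y ∈ ⋃ z ∈ s, range (c z) := hs ▸ mem_univ y
    simp only [mem_iUnion] at hy
    obtain ⟨z, hz, hy⟩ := hy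
    have hzR : range (c z) ∈ R := Finset.mem_image_of_mem _ hz
    refine mem_iUnion.2 ⟨R.equivFin ⟨_, hzR⟩, ?_⟩
    simp only [x', Equiv.symm_apply_apply, hx]
    exact hy

end IsometricAtlas

/-! ### The local normal form of a real structure. -/

section RealSurface

lemma mem_contDiffGroupoid_restrictScalars {e : OpenPartialHomeomorph ℂ ℂ}
    (he : e ∈ contDiffGroupoid ω 𝓘(ℂ, ℂ)) : e ∈ contDiffGroupoid ∞ 𝓘(ℝ, ℂ) := by
  rw [contDiffGroupoid, mem_groupoid_of_pregroupoid, contDiffPregroupoid] at he ⊢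
  simp only [mfld_simps] at he ⊢
  exact ⟨(he.1.restrict_scalars ℝ).of_le le_top, (he.2.restrict_scalars ℝ).of_le le_top⟩

variable {S : Type*} [TopologicalSpace S] [ChartedSpace ℂ S]

/-- The smooth real surface underlying a Riemann surface. -/
lemma isManifold_real_of_complex [IsManifold 𝓘(ℂ, ℂ) ω S] : IsManifold 𝓘(ℝ, ℂ) ∞ S where
  compatible he he' :=
    mem_contDiffGroupoid_restrictScalars (StructureGroupoid.compatible _ he he')

lemma mem_maximalAtlas_real_of_complex {e : OpenPartialHomeomorph S ℂ}
    (he : e ∈ IsManifold.maximalAtlas 𝓘(ℂ, ℂ) ω S) :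
    e ∈ IsManifold.maximalAtlas 𝓘(ℝ, ℂ) ∞ S := by
  rw [IsManifold.mem_maximalAtlas_iff, mem_maximalAtlas_iff] at he ⊢
  exact fun e' he' => (he e' he').imp mem_contDiffGroupoid_restrictScalars
    mem_contDiffGroupoid_restrictScalars

lemma contDiffOn_transition [IsManifold 𝓘(ℂ, ℂ) ω S] (x y : S) :
    ContDiffOn ℂ ω (chartAt ℂ y ∘ (chartAt ℂ x).symm)
      ((chartAt ℂ x).symm.trans (chartAt ℂ y)).source := by
  have h := (contDiffGroupoid ω 𝓘(ℂ, ℂ)).compatible (chart_mem_atlas ℂ x) (chart_mem_atlas ℂ y)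
  rw [contDiffGroupoid, mem_groupoid_of_pregroupoid, contDiffPregroupoid] at h
  have h1 := h.1
  simp only [mfld_simps] at h1 ⊢
  exact h1

lemma hasDerivAt_transition [IsManifold 𝓘(ℂ, ℂ) ω S] (x y z : S)
    (hx : z ∈ (chartAt ℂ x).source) (hy : z ∈ (chartAt ℂ y).source) :
    ∃ l : ℂ, HasDerivAt (chartAt ℂ y ∘ (chartAt ℂ x).symm) l (chartAt ℂ x z) := by
  have hmem : chartAt ℂ x z ∈ ((chartAt ℂ x).symm.trans (chartAt ℂ y)).source := by
    simp [hx, hy]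
  have h := (contDiffOn_transition x y).contDiffAt
    (((chartAt ℂ x).symm.trans (chartAt ℂ y)).open_source.mem_nhds hmem)
  exact ⟨_, (h.differentiableAt (by simp)).hasDerivAt⟩

variable {τ : S → S}

lemma IsRealStructure.continuous (hτ : IsRealStructure τ) : Continuous τ :=
  hτ.mdifferentiable.continuous

/-- Conjugating the coordinate expression of a real structure gives a holomorphic function. -/
lemma IsRealStructure.hasDerivAt_conj [IsManifold 𝓘(ℂ, ℂ) ω S] (hτ : IsRealStructure τ)
    (p x : S) (hx : x ∈ (chartAt ℂ p).source) (hτx : τ x ∈ (chartAt ℂ p).source) :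
    ∃ d : ℂ, HasDerivAt (fun z => conj (chartAt ℂ p (τ ((chartAt ℂ p).symm z)))) d
      (chartAt ℂ p x) := by
  set φ := chartAt ℂ p with hφ
  obtain ⟨l₁, h₁⟩ := hasDerivAt_transition p x x hx (mem_chart_source ℂ x)
  obtain ⟨l₂, h₂⟩ := hasDerivAt_transition (τ x) p (τ x) (mem_chart_source ℂ _) hτx
  -- `mfderiv` is the derivative in the preferred charts at `x` and `τ x`, so antilinearity is
  -- available only there. The holomorphic transitions to `φ` contribute the complex factors `l₁`
  -- and `l₂`.
  obtain ⟨M, hM, hanti⟩ : ∃ M : ℂ →L[ℝ] ℂ,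
      HasFDerivWithinAt (writtenInExtChartAt 𝓘(ℝ, ℂ) 𝓘(ℝ, ℂ) x τ) M (range 𝓘(ℝ, ℂ))
        (extChartAt 𝓘(ℝ, ℂ) x x) ∧ ∀ v : ℂ, M v = conj v * M 1 := by
    refine ⟨_, (hτ.mdifferentiable x).hasMFDerivAt.2, fun v => ?_⟩
    have h := hτ.antilinear x v (1 : ℂ)
    have h1 : (v • (1 : ℂ)) = v := by simp
    conv_lhs => rw [← h1]
    exact h
  have hM' : HasFDerivAt (chartAt ℂ (τ x) ∘ τ ∘ (chartAt ℂ x).symm) M (chartAt ℂ x x) := by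
    rw [← hasFDerivWithinAt_univ]
    simpa [writtenInExtChartAt, mfld_simps] using hM
  have h₁' := h₁.hasFDerivAt.restrictScalars ℝ
  have h₂' := h₂.hasFDerivAt.restrictScalars ℝ
  have hφx : φ.symm (φ x) = x := φ.left_inv hx
  have e1 : (chartAt ℂ x ∘ φ.symm) (φ x) = chartAt ℂ x x := by simp [hφx]
  have e2 : (chartAt ℂ (τ x) ∘ τ ∘ (chartAt ℂ x).symm) (chartAt ℂ x x) = chartAt ℂ (τ x) (τ x) := by
    simp
  have hcomp := (e2 ▸ h₂' : HasFDerivAt (𝕜 := ℝ) _ _ _).comp _ hM'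
  have hcomp2 := (e1 ▸ hcomp : HasFDerivAt (𝕜 := ℝ) _ _ _).comp _ h₁'
  have hcomp3 := (Complex.conjCLE.toContinuousLinearMap.hasFDerivAt).comp _ hcomp2
  obtain ⟨D, hD, hDv⟩ : ∃ D : ℂ →L[ℝ] ℂ,
      HasFDerivAt (fun z => conj (φ (τ (φ.symm z)))) D (φ x) ∧
        ∀ v, D v = v * (conj (M 1 * l₂) * l₁) := by
    refine ⟨_, hcomp3.congr_of_eventuallyEq ?_, fun v => ?_⟩
    · have c1 : ContinuousAt φ.symm (φ x) := φ.continuousAt_symm (φ.map_source hx)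
      have c2 : ContinuousAt (fun z => τ (φ.symm z)) (φ x) := hτ.continuous.continuousAt.comp c1
      filter_upwards [c1 ((chartAt ℂ x).open_source.mem_nhds (by simp [hφx])),
        c2 ((chartAt ℂ (τ x)).open_source.mem_nhds (by simp [hφx]))] with z hz1 hz2
      have a1 := (chartAt ℂ x).left_inv hz1
      have a2 := (chartAt ℂ (τ x)).left_inv hz2
      change conj (φ (τ (φ.symm z))) = conj (φ ((chartAt ℂ (τ x)).symm
        (chartAt ℂ (τ x) (τ ((chartAt ℂ x).symm (chartAt ℂ x (φ.symm z)))))))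
      rw [a1, a2]
    · simp only [ContinuousLinearMap.coe_restrictScalars',
        ContinuousLinearMap.toSpanSingleton_apply, ContinuousLinearMap.comp_apply, smul_eq_mul,
        ContinuousLinearEquiv.coe_coe, Complex.conjCLE_apply]
      rw [hanti]
      simp
      ring
  refine ⟨conj (M 1 * l₂) * l₁, ?_⟩
  rw [hasDerivAt_iff_hasFDerivAt]
  refine hasFDerivAt_of_restrictScalars ℝ hD ?_
  ext
  simp [hDv]

/-- Near a fixed point, a real structure is complex conjugation in a suitable holomorphic chart;
in particular its fixed points are the points with real coordinate. -/
theorem IsRealStructure.exists_chart [IsManifold 𝓘(ℂ, ℂ) ω S] (hτ : IsRealStructure τ)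
    {p : S} (hp : τ p = p) :
    ∃ φ ∈ IsManifold.maximalAtlas 𝓘(ℂ, ℂ) ω S, p ∈ φ.source ∧
      ∀ x ∈ φ.source, τ x = x ↔ (φ x).im = 0 := by
  set φ₀ := chartAt ℂ p with hφ₀
  have hpφ₀ : p ∈ φ₀.source := mem_chart_source ℂ p
  set g : ℂ → ℂ := fun z => conj (φ₀ (τ (φ₀.symm z))) with hg
  set V : Set ℂ := φ₀.target ∩ φ₀.symm ⁻¹' (τ ⁻¹' φ₀.source) with hV
  have hVo : IsOpen V :=
    φ₀.isOpen_inter_preimage_symm (φ₀.open_source.preimage hτ.continuous)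
  have hgV : ∀ z ∈ V, DifferentiableAt ℂ g z := fun z hz => by
    obtain ⟨d, hd⟩ := hτ.hasDerivAt_conj p (φ₀.symm z) (φ₀.map_target hz.1) hz.2
    rw [← hφ₀, φ₀.right_inv hz.1] at hd
    exact hd.differentiableAt
  have hpV : φ₀ p ∈ V := by
    refine ⟨φ₀.map_source hpφ₀, ?_⟩
    simp only [mem_preimage, φ₀.left_inv hpφ₀, hp, hpφ₀]
  -- `b = 1` works unless the derivative of `g` is `-1`, in which case `b = I` gives `2 * I`.
  obtain ⟨b, hb⟩ : ∃ b : ℂ, b + conj b * deriv g (φ₀ p) ≠ 0 := by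
    by_cases h : (1 : ℂ) + deriv g (φ₀ p) = 0
    · refine ⟨Complex.I, ?_⟩
      rw [eq_neg_of_add_eq_zero_right h, Complex.conj_I]
      simp [← two_mul]
    · exact ⟨1, by simpa using h⟩
  set f : ℂ → ℂ := fun z => b * z + conj b * g z with hf
  have hfV : DifferentiableOn ℂ f V := fun z hz =>
    ((differentiableAt_id.const_mul b).add ((hgV z hz).const_mul _)).differentiableWithinAt
  have hfC : ContDiffAt ℂ ω f (φ₀ p) :=
    ((hfV.analyticOnNhd hVo) _ hpV).contDiffAt
  have hfd : HasDerivAt f (b + conj b * deriv g (φ₀ p)) (φ₀ p) := by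
    have h := ((hasDerivAt_id' (φ₀ p)).const_mul b).fun_add
      ((hgV _ hpV).hasDerivAt.const_mul (conj b))
    rwa [mul_one] at h
  have hconj : ∀ x ∈ φ₀.source, τ x ∈ φ₀.source → f (φ₀ (τ x)) = conj (f (φ₀ x)) :=
      fun x hx hx' => by
    simp only [hf, hg, φ₀.left_inv hx, φ₀.left_inv hx', hτ.involutive x, map_add, map_mul,
      Complex.conj_conj]
    ring
  set k₀ := hfC.toOpenPartialHomeomorph f (hfd.hasFDerivAt_equiv hb) (by simp) with hk₀
  have hpk₀ : φ₀ p ∈ k₀.source := hfC.mem_toOpenPartialHomeomorph_source _ (by simp)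
  -- Keep only the points where `k₀` and its inverse are both analytic, so that composing with it
  -- stays in the maximal atlas.
  set k := (k₀.restrContDiff ℂ ω (by simp)).restr V with hk
  have hks : k.source ⊆ (k₀.restrContDiff ℂ ω (by simp)).source := inter_subset_left
  have hkt : k.target ⊆ (k₀.restrContDiff ℂ ω (by simp)).target := inter_subset_left
  have hpk : φ₀ p ∈ k.source := by
    rw [hk, OpenPartialHomeomorph.restr_source' _ _ hVo]
    refine ⟨?_, hpV⟩
    rw [OpenPartialHomeomorph.restrContDiff_source]
    refine ⟨hpk₀, hfC, ?_⟩
    refine k₀.contDiffAt_symm_deriv hb (k₀.map_source hpk₀) ?_ ?_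
    · rw [k₀.left_inv hpk₀]; exact hfd
    · rw [k₀.left_inv hpk₀]; exact hfC
  set φ₁ := φ₀.trans k with hφ₁
  have hφ₁s : φ₁.source = φ₀.source ∩ φ₀ ⁻¹' k.source := by simp [hφ₁]
  have hpφ₁ : p ∈ φ₁.source := hφ₁s ▸ ⟨hpφ₀, hpk⟩
  have hφ₁m : φ₁ ∈ IsManifold.maximalAtlas 𝓘(ℂ, ℂ) ω S := by
    have hm := IsManifold.chart_mem_maximalAtlas (I := 𝓘(ℂ, ℂ)) (n := ω) p
    apply OpenPartialHomeomorph.mem_maximalAtlas_of_contMDiffOn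
    · have h1 : ContDiffOn ℂ ω k k.source := (k₀.contDiffOn_restrContDiff_source ℂ _).mono hks
      exact h1.contMDiffOn.comp ((contMDiffOn_of_mem_maximalAtlas hm).mono (hφ₁s.subset.trans inter_subset_left))
        (fun x hx => (hφ₁s ▸ hx).2)
    · have h1 : ContDiffOn ℂ ω k.symm k.target :=
        (k₀.contDiffOn_restrContDiff_target ℂ _).mono hkt
      have hφ₁t : φ₁.target = k.target ∩ k.symm ⁻¹' φ₀.target := by simp [hφ₁]
      exact (contMDiffOn_symm_of_mem_maximalAtlas hm).comp
        (h1.contMDiffOn.mono (hφ₁t.subset.trans inter_subset_left)) (fun x hx => (hφ₁t ▸ hx).2)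
  have hφ₁x : ∀ x, φ₁ x = f (φ₀ x) := fun x => rfl
  have ho : IsOpen (τ ⁻¹' φ₁.source) := φ₁.open_source.preimage hτ.continuous
  -- Both `x` and `τ x` must lie in the source of `φ₁`: a real coordinate means `φ₁ (τ x) = φ₁ x`,
  -- and injectivity concludes.
  refine ⟨φ₁.restr (τ ⁻¹' φ₁.source), restr_mem_maximalAtlas _ hφ₁m ho, ?_, fun x hx => ?_⟩
  · rw [OpenPartialHomeomorph.restr_source' _ _ ho]
    exact ⟨hpφ₁, by simpa [hp] using hpφ₁⟩
  · rw [OpenPartialHomeomorph.restr_source' _ _ ho] at hx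
    have h1 := hconj x (hφ₁s.subset hx.1).1 (hφ₁s.subset hx.2).1
    rw [← hφ₁x, ← hφ₁x] at h1
    change _ ↔ (φ₁ x).im = 0
    rw [← Complex.conj_eq_iff_im, ← h1]
    exact ⟨fun h => by rw [h], fun h => φ₁.injOn hx.2 hx.1 h⟩

end RealSurface

/-! ### Charts of a curve cut out by the real axis. -/

section RealChart

variable {S : Type*} [TopologicalSpace S] {F : Set S} {φ : OpenPartialHomeomorph S ℂ}

open Classical in
/-- The chart of a subset `F` of a surface obtained from a chart of the surface in which `F`
corresponds to the real line. -/
noncomputable def realChart (h : ∀ x ∈ φ.source, x ∈ F ↔ (φ x).im = 0) (p : F) :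
    OpenPartialHomeomorph F ℝ where
  toFun x := (φ x).re
  -- The value `p` is a default, never taken on the target.
  invFun t := if ht : φ.symm t ∈ F then ⟨φ.symm t, ht⟩ else p
  source := (↑) ⁻¹' φ.source
  target := (↑) ⁻¹' φ.target
  map_source' x hx := by
    have h1 := (h x hx).1 x.2
    have h2 : ((φ x).re : ℂ) = φ x := Complex.ext (by simp) (by simp [h1])
    simp only [mem_preimage] at hx ⊢
    rw [h2]
    exact φ.map_source hx
  map_target' t ht := by
    have h1 : φ.symm t ∈ F := (h _ (φ.map_target ht)).2 (by rw [φ.right_inv ht]; simp)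
    simp only [mem_preimage, dif_pos h1]
    exact φ.map_target ht
  left_inv' x hx := by
    have h1 := (h x hx).1 x.2
    have h2 : ((φ x).re : ℂ) = φ x := Complex.ext (by simp) (by simp [h1])
    have h3 : φ.symm ((φ x).re : ℂ) = x := by rw [h2, φ.left_inv hx]
    simp only [h3, x.2, dif_pos]
  right_inv' t ht := by
    have h1 : φ.symm t ∈ F := (h _ (φ.map_target ht)).2 (by rw [φ.right_inv ht]; simp)
    simp only [dif_pos h1]
    rw [φ.right_inv ht, Complex.ofReal_re]
  open_source := φ.open_source.preimage continuous_subtype_val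
  open_target := φ.open_target.preimage Complex.continuous_ofReal
  continuousOn_toFun := Complex.continuous_re.comp_continuousOn
    (φ.continuousOn.comp continuous_subtype_val.continuousOn (mapsTo_preimage _ _))
  continuousOn_invFun := by
    rw [Topology.IsInducing.subtypeVal.continuousOn_iff]
    refine (φ.symm.continuousOn.comp Complex.continuous_ofReal.continuousOn
      fun _ hx => hx).congr fun t ht => ?_
    have h1 : φ.symm t ∈ F := (h _ (φ.map_target ht)).2 (by rw [φ.right_inv ht]; simp)
    simp only [Function.comp_apply, dif_pos h1]

variable {h : ∀ x ∈ φ.source, x ∈ F ↔ (φ x).im = 0} {p : F}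

lemma mem_realChart_source {x : F} : x ∈ (realChart h p).source ↔ (x : S) ∈ φ.source := Iff.rfl

lemma realChart_symm_apply {t : ℝ} (ht : (t : ℂ) ∈ φ.target) :
    ((realChart h p).symm t : S) = φ.symm t := by
  have h1 : φ.symm t ∈ F := (h _ (φ.map_target ht)).2 (by rw [φ.right_inv ht]; simp)
  exact congrArg Subtype.val (dif_pos h1)

end RealChart

/-! ### Arc length charts. -/

section UnitSpeed

variable {S : Type*} [TopologicalSpace S] [ChartedSpace ℂ S]
  {V : Type*} [NormedAddCommGroup V] [InnerProductSpace ℝ V]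

/-- A chart of a subset `F` of a surface `S` which is smooth and whose inverse is
parametrized by arc length, with respect to a map `E` from `S` to a Euclidean space. -/
structure IsUnitSpeedChart {F : Set S} (E : S → V) (e : OpenPartialHomeomorph F ℝ) : Prop where
  contMDiffAt_symm : ∀ t ∈ e.target,
    ContMDiffAt 𝓘(ℝ, ℝ) 𝓘(ℝ, ℂ) ∞ (fun t => (e.symm t : S)) t
  exists_extension : ∀ x ∈ e.source, ∃ g : S → ℝ,
    ContMDiffAt 𝓘(ℝ, ℂ) 𝓘(ℝ, ℝ) ∞ g x ∧ ∀ᶠ y : F in 𝓝 x, g y = e y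
  norm_deriv : ∀ t ∈ e.target, ‖deriv (fun t => E (e.symm t)) t‖ = 1

variable {F : Set S} {E : S → V}

lemma IsUnitSpeedChart.differentiableAt (hE : ContMDiff 𝓘(ℝ, ℂ) 𝓘(ℝ, V) ∞ E)
    {e : OpenPartialHomeomorph F ℝ} (he : IsUnitSpeedChart E e) {t : ℝ} (ht : t ∈ e.target) :
    DifferentiableAt ℝ (fun t => E (e.symm t)) t := by
  have := (hE _).comp t (he.contMDiffAt_symm t ht)
  exact this.contDiffAt.differentiableAt (by simp)

/-- A function on an interval with derivatives `±1` is affine. -/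
lemma exists_affine_of_deriv {f : ℝ → ℝ} {a r : ℝ} (hr : 0 < r)
    (hf : ∀ t ∈ Metric.ball a r, DifferentiableAt ℝ f t)
    (hf' : ∀ t ∈ Metric.ball a r, |deriv f t| = 1) :
    ∃ σ : ℝ, σ * σ = 1 ∧ ∀ t ∈ Metric.ball a r, f t = f a + σ * (t - a) := by
  have hne : ∀ t ∈ Metric.ball a r, deriv f t ≠ 0 := fun t ht h0 => by
    simpa [h0] using hf' t ht
  obtain ⟨σ, hσ, hd⟩ : ∃ σ : ℝ, σ * σ = 1 ∧ ∀ t ∈ Metric.ball a r, deriv f t = σ := by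
    -- By Darboux's theorem the nonvanishing derivative has constant sign; its continuity is not
    -- needed.
    rcases hasDerivWithinAt_forall_lt_or_forall_gt_of_forall_ne (convex_ball a r)
      (fun t ht => (hf t ht).hasDerivAt.hasDerivWithinAt) hne with h | h
    · refine ⟨-1, by norm_num, fun t ht => ?_⟩
      have := hf' t ht
      rw [abs_of_neg (h t ht)] at this
      linarith
    · refine ⟨1, by norm_num, fun t ht => ?_⟩
      have := hf' t ht
      rwa [abs_of_pos (h t ht)] at this
  refine ⟨σ, hσ, fun t ht => ?_⟩
  have hg : ∀ s ∈ Metric.ball a r, HasDerivAt (fun s => f s - σ * s) 0 s := fun s hs => by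
    have h1 := (hf s hs).hasDerivAt.fun_sub ((hasDerivAt_id' s).const_mul σ)
    rwa [hd s hs, mul_one, sub_self] at h1
  have := Metric.isOpen_ball.is_const_of_deriv_eq_zero (convex_ball a r).isPreconnected
    (fun s hs => (hg s hs).differentiableAt.differentiableWithinAt) (fun s hs => (hg s hs).deriv)
    ht (Metric.mem_ball_self hr)
  linear_combination this

/-- Both inverse charts have unit speed under `E`, so the chain rule gives the transition map a
derivative of absolute value `1`. -/
lemma IsUnitSpeedChart.compatible (hE : ContMDiff 𝓘(ℝ, ℂ) 𝓘(ℝ, V) ∞ E)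
    {e e' : OpenPartialHomeomorph F ℝ} (he : IsUnitSpeedChart E e) (he' : IsUnitSpeedChart E e')
    {x : F} (hx : x ∈ e.source) (hx' : x ∈ e'.source) :
    ∃ σ : ℝ, σ * σ = 1 ∧ ∀ᶠ y in 𝓝 x, e' y = e' x + σ * (e y - e x) := by
  have hmem : e x ∈ (e.symm.trans e').source := by simp [hx, hx']
  obtain ⟨r, hr, hball⟩ := Metric.isOpen_iff.1 (e.symm.trans e').open_source _ hmem
  have hball1 : ∀ t ∈ Metric.ball (e x) r, t ∈ e.target := fun t ht => by
    have := hball ht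
    simp only [OpenPartialHomeomorph.trans_source, OpenPartialHomeomorph.symm_source] at this
    exact this.1
  have hball2 : ∀ t ∈ Metric.ball (e x) r, e.symm t ∈ e'.source := fun t ht => by
    have := hball ht
    simp only [OpenPartialHomeomorph.trans_source, OpenPartialHomeomorph.symm_source] at this
    exact this.2
  have hd : ∀ t ∈ Metric.ball (e x) r, DifferentiableAt ℝ (fun t => e' (e.symm t)) t :=
      fun t ht => by
    obtain ⟨g, hg, hge⟩ := he'.exists_extension _ (hball2 t ht)
    have h1 : ContMDiffAt 𝓘(ℝ, ℝ) 𝓘(ℝ, ℝ) ∞ (fun t => g (e.symm t)) t :=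
      ContMDiffAt.comp t hg (he.contMDiffAt_symm t (hball1 t ht))
    refine (h1.contDiffAt.differentiableAt (by simp)).congr_of_eventuallyEq ?_
    filter_upwards [(e.continuousAt_symm (hball1 t ht)).eventually hge] with s hs
    exact hs.symm
  obtain ⟨σ, hσ, H⟩ := exists_affine_of_deriv hr hd fun t ht => by
    have h1 : (fun t => E (e.symm t)) =ᶠ[𝓝 t]
        (fun t => E (e'.symm t)) ∘ (fun t => e' (e.symm t)) := by
      filter_upwards [Metric.isOpen_ball.mem_nhds ht] with s hs
      simp [hball2 s hs]
    have h2 := h1.deriv_eq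
    have h3 : e' (e.symm t) ∈ e'.target := e'.map_source (hball2 t ht)
    rw [deriv.scomp t (he'.differentiableAt hE h3) (hd t ht)] at h2
    have h4 := congrArg norm h2
    rw [norm_smul, he.norm_deriv t (hball1 t ht), he'.norm_deriv _ h3, mul_one] at h4
    exact h4.symm
  refine ⟨σ, hσ, ?_⟩
  filter_upwards [e.continuousAt hx (Metric.ball_mem_nhds _ hr), e.open_source.mem_nhds hx]
    with y hy hy'
  have := H _ hy
  simpa [hx, hy'] using this

lemma hasDerivAt_integral_of_continuousOn_ball {ρ : ℝ → ℝ} {a r t : ℝ}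
    (hρ : ContinuousOn ρ (Metric.ball a r)) (ht : t ∈ Metric.ball a r) :
    HasDerivAt (fun t => ∫ x in a..t, ρ x) (ρ t) t := by
  have hr : 0 < r := dist_nonneg.trans_lt ht
  refine intervalIntegral.integral_hasDerivAt_right ?_ ?_ ?_
  · apply ContinuousOn.intervalIntegrable
    apply hρ.mono
    rw [← segment_eq_uIcc]
    exact (convex_ball a r).segment_subset (Metric.mem_ball_self hr) ht
  · exact hρ.stronglyMeasurableAtFilter Metric.isOpen_ball t ht
  · exact hρ.continuousAt (Metric.isOpen_ball.mem_nhds ht)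

/-- A positive smooth function on a neighbourhood of `a` is the derivative of a local
diffeomorphism of the line. -/
lemma exists_openPartialHomeomorph_deriv {ρ : ℝ → ℝ} {J : Set ℝ} (hJ : IsOpen J) {a : ℝ}
    (ha : a ∈ J) (hρ : ContDiffOn ℝ ∞ ρ J) (hpos : ∀ t ∈ J, 0 < ρ t) :
    ∃ k : OpenPartialHomeomorph ℝ ℝ, a ∈ k.source ∧ k.source ⊆ J ∧
      (∀ t ∈ k.source, ContDiffAt ℝ ∞ k t) ∧ (∀ t ∈ k.target, ContDiffAt ℝ ∞ k.symm t) ∧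
      ∀ t ∈ k.source, HasDerivAt k (ρ t) t := by
  obtain ⟨r, hr, hball⟩ := Metric.isOpen_iff.1 hJ a ha
  have haB : a ∈ Metric.ball a r := Metric.mem_ball_self hr
  set s : ℝ → ℝ := fun t => ∫ x in a..t, ρ x with hs
  have hd : ∀ t ∈ Metric.ball a r, HasDerivAt s (ρ t) t := fun t ht =>
    hasDerivAt_integral_of_continuousOn_ball (hρ.continuousOn.mono hball) ht
  have hsC : ContDiffOn ℝ ∞ s (Metric.ball a r) := by
    rw [contDiffOn_infty_iff_deriv_of_isOpen Metric.isOpen_ball]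
    exact ⟨fun t ht => (hd t ht).differentiableAt.differentiableWithinAt,
      (hρ.mono hball).congr fun t ht => (hd t ht).deriv⟩
  have hsA : ∀ t ∈ Metric.ball a r, ContDiffAt ℝ ∞ s t := fun t ht =>
    hsC.contDiffAt (Metric.isOpen_ball.mem_nhds ht)
  set k₀ := (hsA a haB).toOpenPartialHomeomorph s
    ((hd a haB).hasFDerivAt_equiv (hpos a ha).ne') (by simp) with hk₀
  have hk : (k₀.restr (Metric.ball a r)).source = k₀.source ∩ Metric.ball a r :=
    k₀.restr_source' _ Metric.isOpen_ball
  have hdk : ∀ t ∈ (k₀.restr (Metric.ball a r)).source,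
      HasDerivAt (k₀.restr (Metric.ball a r)) (ρ t) t := fun t ht => hd t (hk.subset ht).2
  have hCk : ∀ t ∈ (k₀.restr (Metric.ball a r)).source,
      ContDiffAt ℝ ∞ (k₀.restr (Metric.ball a r)) t := fun t ht => hsA t (hk.subset ht).2
  refine ⟨k₀.restr (Metric.ball a r), ?_, ?_, hCk, fun t ht => ?_, hdk⟩
  · rw [hk]
    exact ⟨(hsA a haB).mem_toOpenPartialHomeomorph_source _ _, haB⟩
  · rw [hk]
    exact inter_subset_right.trans hball
  · have hmem := (k₀.restr (Metric.ball a r)).map_target ht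
    exact OpenPartialHomeomorph.contDiffAt_symm_deriv _
      (hpos _ (hball (hk.subset hmem).2)).ne' ht (hdk _ hmem) (hCk _ hmem)

variable {φ : OpenPartialHomeomorph S ℂ}

lemma contMDiffAt_symm_ofReal [IsManifold 𝓘(ℝ, ℂ) ∞ S]
    (hφ : φ ∈ IsManifold.maximalAtlas 𝓘(ℝ, ℂ) ∞ S) {t : ℝ} (ht : (t : ℂ) ∈ φ.target) :
    ContMDiffAt 𝓘(ℝ, ℝ) 𝓘(ℝ, ℂ) ∞ (fun t : ℝ => φ.symm t) t :=
  ContMDiffAt.comp t (contMDiffAt_symm_of_mem_maximalAtlas hφ ht)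
    Complex.ofRealCLM.contDiff.contDiffAt.contMDiffAt

lemma contMDiffAt_realChart_symm [IsManifold 𝓘(ℝ, ℂ) ∞ S]
    (hφ : φ ∈ IsManifold.maximalAtlas 𝓘(ℝ, ℂ) ∞ S) (h : ∀ x ∈ φ.source, x ∈ F ↔ (φ x).im = 0)
    (p : F) {t : ℝ} (ht : (t : ℂ) ∈ φ.target) :
    ContMDiffAt 𝓘(ℝ, ℝ) 𝓘(ℝ, ℂ) ∞ (fun t : ℝ => ((realChart h p).symm t : S)) t := by
  refine (contMDiffAt_symm_ofReal hφ ht).congr_of_eventuallyEq ?_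
  filter_upwards [(realChart h p).open_target.mem_nhds ht] with s hs
  exact realChart_symm_apply hs

lemma contMDiffAt_re [IsManifold 𝓘(ℝ, ℂ) ∞ S]
    (hφ : φ ∈ IsManifold.maximalAtlas 𝓘(ℝ, ℂ) ∞ S) {x : S} (hx : x ∈ φ.source) :
    ContMDiffAt 𝓘(ℝ, ℂ) 𝓘(ℝ, ℝ) ∞ (fun x : S => (φ x).re) x :=
  ContMDiffAt.comp x (Complex.reCLM.contDiff.contDiffAt.contMDiffAt)
    (contMDiffAt_of_mem_maximalAtlas hφ hx)

/-- The curve `t ↦ φ.symm t` has the left inverse `re ∘ φ`, so its velocity is nonzero, and the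
immersion `E` does not kill it. -/
lemma deriv_comp_symm_ofReal_ne_zero [IsManifold 𝓘(ℝ, ℂ) ∞ S]
    (hE : ContMDiff 𝓘(ℝ, ℂ) 𝓘(ℝ, V) ∞ E)
    (hE' : ∀ x, Function.Injective (mfderiv 𝓘(ℝ, ℂ) 𝓘(ℝ, V) E x))
    (hφ : φ ∈ IsManifold.maximalAtlas 𝓘(ℝ, ℂ) ∞ S) {t : ℝ} (ht : (t : ℂ) ∈ φ.target) :
    deriv (fun t : ℝ => E (φ.symm t)) t ≠ 0 := by
  intro h0
  have hc := (contMDiffAt_symm_ofReal hφ ht).mdifferentiableAt (by simp)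
  have hEd := (hE (φ.symm t)).mdifferentiableAt (by simp)
  have hre := (contMDiffAt_re hφ (φ.map_target ht)).mdifferentiableAt (by simp)
  have h1 := mfderiv_comp t hEd hc
  have h2 := mfderiv_comp t hre hc
  have h3 : ((fun x : S => (φ x).re) ∘ fun t : ℝ => φ.symm t) =ᶠ[𝓝 t] id := by
    filter_upwards [(φ.open_target.preimage Complex.continuous_ofReal).mem_nhds ht] with s hs
    simp only [Function.comp_apply, φ.right_inv hs, Complex.ofReal_re, id]
  rw [h3.mfderiv_eq, mfderiv_id] at h2
  have h4 : mfderiv 𝓘(ℝ, ℝ) 𝓘(ℝ, V) (E ∘ fun t : ℝ => φ.symm t) t (1 : ℝ) = (0 : V) := by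
    have h8 : fderiv ℝ (E ∘ fun t : ℝ => φ.symm t) t 1 = 0 :=
      fderiv_apply_one_eq_deriv.trans h0
    rw [mfderiv_eq_fderiv]
    exact h8
  rw [h1] at h4
  have h5 : mfderiv 𝓘(ℝ, ℝ) 𝓘(ℝ, ℂ) (fun t : ℝ => φ.symm t) t (1 : ℝ) = 0 :=
    hE' _ (h4.trans (map_zero _).symm)
  have h6 := DFunLike.congr_fun h2 (1 : ℝ)
  have h7 : (1 : ℝ) = 0 := h6.trans ((congrArg _ h5).trans (ContinuousLinearMap.map_zero _))
  exact one_ne_zero h7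

/-- Arc length charts exist around all points. -/
lemma exists_isUnitSpeedChart [IsManifold 𝓘(ℝ, ℂ) ∞ S]
    (hE : ContMDiff 𝓘(ℝ, ℂ) 𝓘(ℝ, V) ∞ E)
    (hE' : ∀ x, Function.Injective (mfderiv 𝓘(ℝ, ℂ) 𝓘(ℝ, V) E x))
    (hφ : φ ∈ IsManifold.maximalAtlas 𝓘(ℝ, ℂ) ∞ S) (h : ∀ x ∈ φ.source, x ∈ F ↔ (φ x).im = 0)
    {p : F} (hp : (p : S) ∈ φ.source) :
    ∃ e : OpenPartialHomeomorph F ℝ, p ∈ e.source ∧ IsUnitSpeedChart E e := by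
  set J : Set ℝ := {t | (t : ℂ) ∈ φ.target} with hJ
  have hJo : IsOpen J := φ.open_target.preimage Complex.continuous_ofReal
  set u : ℝ → V := fun t => E (φ.symm t) with hu
  have huC : ContDiffOn ℝ ∞ u J := fun t ht =>
    ((hE _).comp t (contMDiffAt_symm_ofReal hφ ht)).contDiffAt.contDiffWithinAt
  have hne : ∀ t ∈ J, deriv u t ≠ 0 := fun t ht => deriv_comp_symm_ofReal_ne_zero hE hE' hφ ht
  -- The norm is smooth away from zero, so the speed is smooth because it never vanishes.
  have hρ : ContDiffOn ℝ ∞ (fun t => ‖deriv u t‖) J :=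
    ((contDiffOn_infty_iff_deriv_of_isOpen hJo).1 huC).2.norm ℝ hne
  have hpJ : realChart h p p ∈ J := (realChart h p).map_source hp
  obtain ⟨k, hpk, hkJ, hkC, hkC', hkd⟩ := exists_openPartialHomeomorph_deriv hJo hpJ hρ
    fun t ht => norm_pos_iff.2 (hne t ht)
  refine ⟨(realChart h p).trans k, ?_, ?_, ?_, ?_⟩
  · rw [OpenPartialHomeomorph.trans_source]
    exact ⟨hp, hpk⟩
  · intro t ht
    rw [OpenPartialHomeomorph.trans_target] at ht
    exact ContMDiffAt.comp (g := fun s => ((realChart h p).symm s : S)) (f := k.symm) t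
      (contMDiffAt_realChart_symm hφ h p ht.2) (hkC' t ht.1).contMDiffAt
  · intro x hx
    rw [OpenPartialHomeomorph.trans_source] at hx
    exact ⟨fun y => k (φ y).re, ContMDiffAt.comp (x : S) (hkC _ hx.2).contMDiffAt
      (contMDiffAt_re hφ hx.1), Eventually.of_forall fun y => rfl⟩
  · intro t ht
    have htk : t ∈ k.target := by
      rw [OpenPartialHomeomorph.trans_target] at ht
      exact ht.1
    have hmem := k.map_target htk
    have h1 : (fun t => E (((realChart h p).trans k).symm t)) =ᶠ[𝓝 t] u ∘ k.symm := by
      filter_upwards [((realChart h p).trans k).open_target.mem_nhds ht] with s hs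
      rw [OpenPartialHomeomorph.trans_target] at hs
      exact congrArg E (realChart_symm_apply (h := h) hs.2)
    have hud : DifferentiableAt ℝ u (k.symm t) :=
      (huC.contDiffAt (hJo.mem_nhds (hkJ hmem))).differentiableAt (by simp)
    have hkd' : HasDerivAt k.symm (‖deriv u (k.symm t)‖)⁻¹ t :=
      k.hasDerivAt_symm htk (norm_ne_zero_iff.2 (hne _ (hkJ hmem))) (hkd _ hmem)
    rw [h1.deriv_eq, deriv.scomp t hud hkd'.differentiableAt, hkd'.deriv, norm_smul, norm_inv,
      norm_norm, inv_mul_cancel₀ (norm_ne_zero_iff.2 (hne _ (hkJ hmem)))]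

end UnitSpeed

/-! ### From periodic arc length curves to smoothly embedded circles. -/

section Circles

variable {S : Type*} [TopologicalSpace S] [ChartedSpace ℂ S] [IsManifold 𝓘(ℝ, ℂ) ∞ S] {F : Set S}

/-- The linear identification of one-dimensional Euclidean space with `ℝ`. -/
noncomputable def euclideanFinOneEquiv : EuclideanSpace ℝ (Fin 1) ≃L[ℝ] ℝ :=
  (EuclideanSpace.equiv (Fin 1) ℝ).trans (ContinuousLinearEquiv.funUnique (Fin 1) ℝ ℝ)

/-- The identification of a plane with `ℂ` taking the first axis to the real line. -/
noncomputable def euclideanFinOneProdEquiv : (EuclideanSpace ℝ (Fin 1) × ℝ) ≃L[ℝ] ℂ :=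
  (euclideanFinOneEquiv.prodCongr (ContinuousLinearEquiv.refl ℝ ℝ)).trans
    Complex.equivRealProdCLM.symm

lemma euclideanFinOneProdEquiv_apply_zero (u : EuclideanSpace ℝ (Fin 1)) :
    euclideanFinOneProdEquiv (u, 0) = (euclideanFinOneEquiv u : ℂ) := by
  apply Complex.ext <;> simp [euclideanFinOneProdEquiv]

/-- A smooth homeomorphism from the circle to an open part of a smooth curve in a surface is a
smooth embedding if its inverse is smooth. -/
lemma isSmoothEmbedding_of_isOpenEmbedding
    (hF : ∀ p ∈ F, ∃ φ ∈ IsManifold.maximalAtlas 𝓘(ℝ, ℂ) ∞ S, p ∈ φ.source ∧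
      ∀ x ∈ φ.source, x ∈ F ↔ (φ x).im = 0)
    {c : Circle → F} (hc : IsOpenEmbedding c)
    (hsm : ContMDiff (𝓡 1) 𝓘(ℝ, ℂ) ∞ (fun z => (c z : S)))
    (hinv : ∀ z, ∃ g : S → Circle, ContMDiffAt 𝓘(ℝ, ℂ) (𝓡 1) ∞ g (c z) ∧
      ∀ᶠ w in 𝓝 z, g (c w) = w) :
    Manifold.IsSmoothEmbedding (𝓡 1) 𝓘(ℝ, ℂ) ∞ (fun z => (c z : S)) := by
  refine ⟨⟨ℝ, inferInstance, inferInstance, fun z => ?_⟩,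
    IsEmbedding.subtypeVal.comp hc.isEmbedding⟩
  obtain ⟨φ, hφ, hzφ, h⟩ := hF (c z) (c z).2
  set r := realChart h (c z) with hr
  set L := euclideanFinOneEquiv with hL
  -- Transporting the chart of the curve to the circle makes `c` read as `u ↦ (u, 0)`, the normal
  -- form of an immersion.
  set d : OpenPartialHomeomorph Circle (EuclideanSpace ℝ (Fin 1)) :=
    ((hc.toOpenPartialHomeomorph c).trans r).trans L.symm.toHomeomorph.toOpenPartialHomeomorph
    with hd
  have hds : ∀ x, x ∈ d.source ↔ (c x : S) ∈ φ.source := fun x => by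
    simp [hd, hr, mem_realChart_source]
  have hdx : ∀ x, d x = L.symm (φ (c x)).re := fun x => rfl
  have hdt : ∀ u ∈ d.target, ((L u : ℝ) : ℂ) ∈ φ.target := fun u hu => by
    have := d.map_target hu
    rw [hds] at this
    have h2 : d (d.symm u) = u := d.right_inv hu
    rw [hdx, ContinuousLinearEquiv.symm_apply_eq] at h2
    rw [← h2]
    exact r.map_source this
  have hcd : ∀ u ∈ d.target, c (d.symm u) = r.symm (L u) := fun u hu => by
    have h1 := d.map_target hu
    rw [hds] at h1
    have h2 : d (d.symm u) = u := d.right_inv hu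
    rw [hdx, ContinuousLinearEquiv.symm_apply_eq] at h2
    rw [← h2]
    exact (r.left_inv h1).symm
  have : IsManifold (𝓡 1) ∞ Circle := IsManifold.of_le (n := ω) le_top
  refine Manifold.IsImmersionAtOfComplement.mk_of_charts euclideanFinOneProdEquiv d φ
    ((hds z).2 hzφ) hzφ ?_ hφ (fun x hx => (hds x).1 hx) ?_
  · apply OpenPartialHomeomorph.mem_maximalAtlas_of_contMDiffOn
    · intro x hx
      have h1 : ContMDiffAt (𝓡 1) 𝓘(ℝ, ℝ) ∞ (fun x => (φ (c x)).re) x :=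
        ContMDiffAt.comp (g := fun y : S => (φ y).re) x (contMDiffAt_re hφ ((hds x).1 hx)) (hsm x)
      exact (ContMDiffAt.comp (g := L.symm) x L.symm.contDiff.contDiffAt.contMDiffAt
        h1).contMDiffWithinAt
    · intro u hu
      -- Near `u`, `d.symm` equals `g ∘ r.symm ∘ L`, a composite of smooth maps through the surface.
      obtain ⟨g, hg, hge⟩ := hinv (d.symm u)
      have h1 : ContMDiffAt (𝓡 1) 𝓘(ℝ, ℂ) ∞ (fun v => (r.symm (L v) : S)) u :=
        ContMDiffAt.comp (g := fun t => (r.symm t : S)) u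
          (contMDiffAt_realChart_symm hφ h _ (hdt u hu)) L.contDiff.contDiffAt.contMDiffAt
      rw [hcd u hu] at hg
      have h2 : ContMDiffAt (𝓡 1) (𝓡 1) ∞ (fun v => g (r.symm (L v))) u :=
        ContMDiffAt.comp (g := g) u hg h1
      refine (h2.congr_of_eventuallyEq ?_).contMDiffWithinAt
      filter_upwards [(d.continuousAt_symm hu).eventually hge, d.open_target.mem_nhds hu]
        with v hv hv'
      rw [← hcd v hv', hv]
  · intro u hu
    have hu' : u ∈ d.target := by simpa using hu
    have h1 : φ (c (d.symm u)) = (L u : ℂ) := by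
      rw [hcd u hu', realChart_symm_apply (hdt u hu'), φ.right_inv (hdt u hu')]
    simpa [euclideanFinOneProdEquiv_apply_zero] using h1

variable {V : Type*} [NormedAddCommGroup V] [InnerProductSpace ℝ V] {E : S → V}

omit [IsManifold 𝓘(ℝ, ℂ) ∞ S] in
lemma IsLocalIsometryAt.contMDiffAt {γ : ℝ → F} {t : ℝ}
    (h : IsLocalIsometryAt {e : OpenPartialHomeomorph F ℝ | IsUnitSpeedChart E e} γ t) :
    ContMDiffAt 𝓘(ℝ, ℝ) 𝓘(ℝ, ℂ) ∞ (fun t => (γ t : S)) t := by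
  obtain ⟨e, he, hx, σ, -, H⟩ := h
  have h1 : ContMDiffAt 𝓘(ℝ, ℝ) 𝓘(ℝ, ℝ) ∞ (fun s => e (γ t) + σ * (s - t)) t :=
    ContDiffAt.contMDiffAt (by fun_prop)
  have h0 : e (γ t) + σ * (t - t) = e (γ t) := by ring
  have h2 : ContMDiffAt 𝓘(ℝ, ℝ) 𝓘(ℝ, ℂ) ∞ (fun s => (e.symm (e (γ t) + σ * (s - t)) : S)) t :=
    ContMDiffAt.comp (g := fun s => (e.symm s : S)) t
      (by rw [h0]; exact he.contMDiffAt_symm _ (e.map_source hx)) h1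
  refine h2.congr_of_eventuallyEq ?_
  filter_upwards [H] with s hs
  rw [hs]

lemma contMDiff_circle_coe : ContMDiff (𝓡 1) 𝓘(ℝ, ℂ) ∞ (fun z : Circle => (z : ℂ)) :=
  have := finrank_real_complex_fact'
  contMDiff_coe_sphere (E := ℂ) (n := 1)

/-- Rotating `z₀` to `1` moves it off the branch cut of the logarithm. -/
lemma contMDiffAt_arg_div (z₀ : Circle) :
    ContMDiffAt (𝓡 1) 𝓘(ℝ, ℝ) ∞ (fun z : Circle => Complex.arg (z * z₀⁻¹ : Circle)) z₀ := by
  have h1 : ContMDiffAt (𝓡 1) 𝓘(ℝ, ℂ) ∞ (fun z : Circle => ((z * z₀⁻¹ : Circle) : ℂ)) z₀ := by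
    have h2 : ContMDiff (𝓡 1) (𝓡 1) ω (fun z : Circle => z * z₀⁻¹) := contMDiff_mul_right
    exact ContMDiffAt.comp (g := fun z : Circle => (z : ℂ)) z₀
      (contMDiff_circle_coe _) ((h2 z₀).of_le le_top)
  have h3 : ContDiffAt ℝ ∞ (fun z : ℂ => (Complex.log z).im) ((z₀ * z₀⁻¹ : Circle) : ℂ) := by
    have h4 : ContDiffAt ℂ ∞ Complex.log ((z₀ * z₀⁻¹ : Circle) : ℂ) :=
      Complex.contDiffAt_log (by simp)
    exact Complex.imCLM.contDiff.contDiffAt.comp _ (h4.restrict_scalars ℝ)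
  exact ContMDiffAt.comp (g := Complex.arg) z₀ (by simpa [Complex.log_im] using h3.contMDiffAt) h1

/-- A periodic local isometry descends to a smooth embedding of the circle. -/
lemma exists_isSmoothEmbedding_of_periodic [T2Space S]
    (hF : ∀ p ∈ F, ∃ φ ∈ IsManifold.maximalAtlas 𝓘(ℝ, ℂ) ∞ S, p ∈ φ.source ∧
      ∀ x ∈ φ.source, x ∈ F ↔ (φ x).im = 0)
    (hA : IsIsometricAtlas {e : OpenPartialHomeomorph F ℝ | IsUnitSpeedChart E e})
    {γ : ℝ → F} {T : ℝ} (hT : 0 < T)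
    (hγ : ∀ t, IsLocalIsometryAt {e : OpenPartialHomeomorph F ℝ | IsUnitSpeedChart E e} γ t)
    (hper : ∀ s t, γ s = γ t ↔ ∃ k : ℤ, s = t + k * T) :
    ∃ c : Circle → F, Manifold.IsSmoothEmbedding (𝓡 1) 𝓘(ℝ, ℂ) ∞ (fun z => (c z : S)) ∧
      range c = range γ := by
  obtain ⟨a, ha, haT⟩ : ∃ a : ℝ, 0 < a ∧ a * (2 * Real.pi) = T :=
    ⟨T / (2 * Real.pi), by positivity, by field_simp⟩
  have hδ : ∀ s t, γ (a * s) = γ (a * t) ↔ Circle.exp s = Circle.exp t := fun s t => by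
    rw [hper, Circle.exp_eq_exp]
    refine exists_congr fun k => ?_
    rw [← haT]
    constructor
    · intro h
      have : a * (s - (t + k * (2 * Real.pi))) = 0 := by linear_combination h
      linarith [(mul_eq_zero.1 this).resolve_left ha.ne']
    · rintro rfl
      ring
  -- The jump of `arg` is harmless since `s ↦ γ (a * s)` has period `2π`: near `z₀`, the angle may
  -- be replaced by `arg z₀ + arg (z * z₀⁻¹)`.
  set c : Circle → F := fun z => γ (a * Complex.arg z) with hc
  have hcexp : ∀ s, c (Circle.exp s) = γ (a * s) := fun s => by
    simp only [hc, hδ, Circle.exp_arg]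
  have hinj : Function.Injective c := fun z w h => by
    simpa only [hc, hδ, Circle.exp_arg] using h
  have hrange : range c = range γ := by
    apply Subset.antisymm
    · rintro _ ⟨z, rfl⟩
      exact ⟨_, rfl⟩
    · rintro _ ⟨t, rfl⟩
      refine ⟨Circle.exp (a⁻¹ * t), ?_⟩
      rw [hcexp, mul_inv_cancel_left₀ ha.ne']
  have hγs : ContMDiff 𝓘(ℝ, ℝ) 𝓘(ℝ, ℂ) ∞ (fun t => (γ t : S)) := fun t => (hγ t).contMDiffAt
  have hsm : ContMDiff (𝓡 1) 𝓘(ℝ, ℂ) ∞ (fun z => (c z : S)) := fun z₀ => by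
    have h1 : (fun z => (c z : S)) = (fun t => (γ t : S)) ∘
        (fun z : Circle => a * (Complex.arg z₀ + Complex.arg (z * z₀⁻¹ : Circle))) := by
      ext z
      simp only [Function.comp_apply]
      rw [← hcexp, Circle.exp_add, Circle.exp_arg, Circle.exp_arg]
      rw [mul_left_comm, mul_inv_cancel, mul_one]
    rw [h1]
    refine (hγs _).comp z₀ ?_
    have h2 : ContDiff ℝ ∞ (fun x : ℝ => a * (Complex.arg z₀ + x)) := by fun_prop
    exact ContMDiffAt.comp (g := fun x : ℝ => a * (Complex.arg z₀ + x)) z₀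
      h2.contDiffAt.contMDiffAt (contMDiffAt_arg_div z₀)
  have hcont : Continuous c := continuous_induced_rng.2 hsm.continuous
  have hopen : IsOpenEmbedding c :=
    ⟨(hcont.isClosedEmbedding hinj).isEmbedding, hrange ▸ (hA.isOpenMap hγ).isOpen_range⟩
  refine ⟨c, isSmoothEmbedding_of_isOpenEmbedding hF hopen hsm fun z => ?_, hrange⟩
  obtain ⟨e, he, hx, σ, -, H⟩ := (hγ (a * Complex.arg z)).exists_eventually_apply_eq hA
  obtain ⟨g, hg, hge⟩ := he.exists_extension _ hx
  set t := a * Complex.arg z with ht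
  -- On the curve this recovers the time from the arc length coordinate, whose extension `g` makes
  -- it smooth on the surface, and then returns to the circle.
  refine ⟨fun y => Circle.exp (a⁻¹ * (t + σ * (g y - e (γ t)))), ?_, ?_⟩
  · have h2 : ContDiff ℝ ∞ (fun x : ℝ => a⁻¹ * (t + σ * (x - e (γ t)))) := by fun_prop
    have h3 : ContMDiffAt 𝓘(ℝ, ℂ) 𝓘(ℝ, ℝ) ∞ (fun y => a⁻¹ * (t + σ * (g y - e (γ t))))
        (c z : S) :=
      ContMDiffAt.comp (g := fun x : ℝ => a⁻¹ * (t + σ * (x - e (γ t)))) _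
        h2.contDiffAt.contMDiffAt hg
    exact ContMDiffAt.comp (g := Circle.exp) _ (contMDiff_circleExp _) h3
  · filter_upwards [hcont.continuousAt.eventually H, hcont.continuousAt.eventually hge]
      with w hw hw'
    apply hinj
    rw [hcexp, mul_inv_cancel_left₀ ha.ne', hw', hw]

/-- A compact smooth curve in a surface is a finite disjoint union of smoothly embedded circles. -/
theorem exists_finite_smooth_circles [T2Space S] [CompactSpace S] (hFc : IsClosed F)
    (hF : ∀ p ∈ F, ∃ φ ∈ IsManifold.maximalAtlas 𝓘(ℝ, ℂ) ∞ S, p ∈ φ.source ∧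
      ∀ x ∈ φ.source, x ∈ F ↔ (φ x).im = 0) :
    ∃ (n : ℕ) (γ : Fin n → Circle → S),
      (∀ i, Manifold.IsSmoothEmbedding (𝓡 1) 𝓘(ℝ, ℂ) ∞ (γ i)) ∧
      Pairwise (fun i j => Disjoint (Set.range (γ i)) (Set.range (γ j))) ∧
      F = ⋃ i, Set.range (γ i) := by
  -- `E` serves to measure length: its injective differential gives the curve nonzero speed in a
  -- Euclidean space.
  obtain ⟨N, E, hE, -, hE'⟩ := exists_embedding_euclidean_of_compact (I := 𝓘(ℝ, ℂ)) (M := S)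
  have hA : IsIsometricAtlas {e : OpenPartialHomeomorph F ℝ | IsUnitSpeedChart E e} := by
    refine ⟨fun p => ?_, fun e he e' he' x hx hx' => he.compatible hE he' hx hx'⟩
    obtain ⟨φ, hφ, hp, h⟩ := hF p p.2
    obtain ⟨e, hpe, he⟩ := exists_isUnitSpeedChart hE hE' hφ h hp
    exact ⟨e, he, hpe⟩
  have : CompactSpace F := isCompact_iff_compactSpace.1 hFc.isCompact
  obtain ⟨n, γ, T, hT, hγ, hper, hdisj, hcov⟩ := hA.exists_finite_circles
  choose c hc hcγ using fun i => exists_isSmoothEmbedding_of_periodic hF hA (hT i) (hγ i) (hper i)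
  have hr : ∀ i, range (fun z => (c i z : S)) = (↑) '' range (γ i) := fun i => by
    rw [← hcγ, ← range_comp]
    rfl
  refine ⟨n, fun i z => c i z, hc, fun i j hij => ?_, ?_⟩
  · simp only [hr]
    exact (disjoint_image_iff Subtype.val_injective).2 (hdisj hij)
  · simp only [hr]
    rw [← image_iUnion, hcov, image_univ, Subtype.range_coe]

end Circles

end

theorem mainTheorem12 {S : Type*} [TopologicalSpace S] [T2Space S] [CompactSpace S]
    [ConnectedSpace S] [ChartedSpace ℂ S] [IsManifold 𝓘(ℂ, ℂ) ω S]
    (τ : S → S) (hτ : IsRealStructure τ) :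
    ∃ (n : ℕ) (γ : Fin n → Circle → S),
      (∀ i, Manifold.IsSmoothEmbedding (𝓡 1) 𝓘(ℝ, ℂ) ∞ (γ i)) ∧
      Pairwise (fun i j => Disjoint (Set.range (γ i)) (Set.range (γ j))) ∧
      Function.fixedPoints τ = ⋃ i, Set.range (γ i) := by
  have := isManifold_real_of_complex (S := S)
  refine exists_finite_smooth_circles (isClosed_fixedPoints hτ.continuous) fun p hp => ?_
  obtain ⟨φ, hφ, hpφ, h⟩ := hτ.exists_chart hp
  exact ⟨φ, mem_maximalAtlas_real_of_complex hφ, hpφ, h⟩
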